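/- Let $\mathfrak c=2^{\aleph_0}$ and $\mathcal C^+=\{1,2,3,\dots,\aleph_0,\mathfrak c\}$. An equivalence relation $E$ on a standard Borel space $X$ is *smooth* if there are a standard Borel space $W$ and a Borel map $f:X\to W$ such that $x\mathrel{E}y\Leftrightarrow f(x)=f(y)$ for all $x,y\in X$, and *countable* if every $E$-class is countable. The *fine shape* of $E$ is the sequence $\mathrm{fs}(E)=\langle \mathfrak n_{\mathfrak m}(E) : \mathfrak m\in\mathcal C^+\rangle$, where $\mathfrak n_{\mathfrak m}(E)$ is the number (a cardinal) of $E$-classes of cardinality $\mathfrak m$. Equivalence relations $E$ on $X$ and $F$ on $Y$ are *Borel isomorphic*, $E\cong_B F$, if there is a Borel bijection $f:X\to Y$ with $x\mathrel{E}y\Leftrightarrow f(x)\mathrel{F}f(y)$ for all $x,y\in X$. Finally, $E$ is *Borel parametrized* if there are a pairwise disjoint sequence $(Z_{\mathfrak m})_{\mathfrak m\in\mathcal C^+}$ of (possibly empty) standard Borel spaces, a sequence $(Y_{\mathfrak m})_{\mathfrak m\in\mathcal C^+}$ of standard Borel spaces with $|Y_{\mathfrak m}|=\mathfrak m$, and a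 Borel bijection $\phi:X\to\bigsqcup_{\mathfrak m\in\mathcal C^+}(Z_{\mathfrak m}\times Y_{\mathfrak m})$ such that $x\mathrel{E}y\Leftrightarrow \pi_1(\phi(x))=\pi_1(\phi(y))$ for all $x,y\in X$, where $\pi_1$ is the projection to the first coordinate. **Proposition.** 1. Let $E$ and $F$ be smooth equivalence relations on standard Borel spaces $X$ and $Y$, each with at most countably many uncountable equivalence classes. Then $E\cong_B F$ if and only if $\mathrm{fs}(E)=\mathrm{fs}(F)$. 2. Every smooth equivalence relation on a standard Borel space with at most countably many uncountable equivalence classes is Borel parametrized. In particular, every smooth countable equivalence relation on a standard Borel space is Borel parametrized. -/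

import Mathlib

universe u

namespace BorelER

/-- A Borel reduction from `E` to `F`: a Borel map `f` with `x E y ↔ f x F f y`. -/
def IsBorelReduction {X Y : Type u} [MeasurableSpace X] [MeasurableSpace Y]
    (E : Setoid X) (F : Setoid Y) (f : X → Y) : Prop :=
  Measurable f ∧ ∀ x y : X, E x y ↔ F (f x) (f y)

/-- `E` is smooth: it is Borel reducible to the equality relation `⊥` of some standard Borel
space. (Such an `E` is automatically a Borel subset of `X × X`.) -/
def IsSmooth {X : Type u} [MeasurableSpace X] (E : Setoid X) : Prop :=
  ∃ (Y : Type u) (_ : MeasurableSpace Y) (_ : StandardBorelSpace Y) (f : X → Y),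
    IsBorelReduction E (⊥ : Setoid Y) f

/-- `E` and `F` are Borel isomorphic: there is a bijective Borel reduction from `E` to `F`. -/
def BorelIsomorphic {X Y : Type u} [MeasurableSpace X] [MeasurableSpace Y]
    (E : Setoid X) (F : Setoid Y) : Prop :=
  ∃ f : X → Y, Function.Bijective f ∧ IsBorelReduction E F f

/-- Every equivalence class is countable. -/
def IsCountable {X : Type u} (E : Setoid X) : Prop :=
  ∀ C ∈ E.classes, C.Countable

/-- At most countably many equivalence classes are uncountable. -/
def CountablyManyUncountableClasses {X : Type u} (E : Setoid X) : Prop :=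
  {C : Set X | C ∈ E.classes ∧ ¬ C.Countable}.Countable

/-- The set `{1, 2, 3, …, ℵ₀, 2^ℵ₀}` of cardinalities of nonempty standard Borel spaces. -/
def CPlus : Set Cardinal.{u} :=
  {m | m ≠ 0 ∧ (m ≤ Cardinal.aleph0 ∨ m = Cardinal.continuum)}

/-- The number of equivalence classes of cardinality `m`. -/
noncomputable def numClasses {X : Type u} (E : Setoid X) (m : Cardinal.{u}) : Cardinal.{u} :=
  Cardinal.mk {C : Set X // C ∈ E.classes ∧ Cardinal.mk C = m}

/-- The fine shape of `E`: the sequence, indexed by `m ∈ {1, 2, 3, …, ℵ₀, 2^ℵ₀}`, of the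
numbers of classes of cardinality `m`. -/
noncomputable def fineShape {X : Type u} (E : Setoid X) : CPlus.{u} → Cardinal.{u} :=
  fun m => numClasses E m

/-- `E` is Borel parametrized: there is a Borel bijection `φ` from `X` onto a disjoint union
`⨆ m, Z m × Y m` over `m ∈ {1, 2, 3, …, ℵ₀, 2^ℵ₀}`, where all `Z m` (possibly empty) and `Y m` are
standard Borel and `Y m` has cardinality `m`, such that `x E y` iff `φ x` and `φ y` have the same
projection to the disjoint union of the `Z m`. -/
def IsBorelParametrized {X : Type u} [MeasurableSpace X] (E : Setoid X) : Prop :=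
  ∃ (Z Y : CPlus.{u} → Type u)
    (_ : ∀ m, MeasurableSpace (Z m)) (_ : ∀ m, StandardBorelSpace (Z m))
    (_ : ∀ m, MeasurableSpace (Y m)) (_ : ∀ m, StandardBorelSpace (Y m))
    (φ : X → Σ m : CPlus.{u}, Z m × Y m),
    (∀ m, Cardinal.mk (Y m) = (m : Cardinal.{u})) ∧
    Measurable φ ∧ Function.Bijective φ ∧
    ∀ x y : X, E x y ↔
      (⟨(φ x).1, (φ x).2.1⟩ : Σ m : CPlus.{u}, Z m) = ⟨(φ y).1, (φ y).2.1⟩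

end BorelER

/-! The core is a normal form, `IsSmooth.exists_measurableEquiv_sigma`: `X` is Borel isomorphic to a
disjoint union of products `Z m × Y m` with `Y m` of size `m`, the classes being the slices over the
points of the `Z m`. Its inverse is the parametrization. The number of classes of size `m` is then
the cardinality of `Z m`, and standard Borel spaces of equal cardinality are Borel isomorphic, so
equal fine shapes allow the factors to be matched.

The uncountable classes are countably many Borel sets, each isomorphic to `ℝ`. On the Borel set of
remaining points the reduction to equality is countable-to-one, and the Lusin–Novikov theorem
(`Measurable.sigmaInjective_univ`) covers this set by countably many Borel sets of injectivity.
Hence each fiber is numbered, in a Borel way, by an initial segment of `ℕ`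
(`exists_measurable_rank`); the fibers of size `m` form a Borel set, and point and number are the
product coordinates.

Lusin–Novikov is a dichotomy. After discarding a `SigmaInjective` set, fibers through finitely many
open sets can always be split further. If anything remains, a Cantor scheme puts a copy of `2^ℕ`
inside a single fiber. -/

section LusinNovikov

open Set Filter Topology MeasureTheory

/-- `S` is covered by countably many measurable sets on each of which `f` is injective. -/
def SigmaInjective {X W : Type*} [MeasurableSpace X] (f : X → W) (S : Set X) : Prop :=
  ∃ B : Set (Set X), B.Countable ∧ (∀ b ∈ B, MeasurableSet b ∧ InjOn f b) ∧ S ⊆ ⋃₀ B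

theorem SigmaInjective.mono {X W : Type*} [MeasurableSpace X] {f : X → W} {S T : Set X}
    (h : SigmaInjective f T) (hST : S ⊆ T) : SigmaInjective f S := by
  obtain ⟨B, hc, hB, hT⟩ := h
  exact ⟨B, hc, hB, hST.trans hT⟩

theorem SigmaInjective.iUnion {X W ι : Type*} [MeasurableSpace X] [Countable ι] {f : X → W}
    {S : ι → Set X} (h : ∀ i, SigmaInjective f (S i)) : SigmaInjective f (⋃ i, S i) := by
  choose B hc hB hS using h
  refine ⟨⋃ i, B i, countable_iUnion hc, fun b hb => ?_, iUnion_subset fun i x hx => ?_⟩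
  · obtain ⟨i, hi⟩ := mem_iUnion.1 hb
    exact hB i b hi
  · obtain ⟨b, hb, hxb⟩ := hS i hx
    exact ⟨b, mem_iUnion.2 ⟨i, hb⟩, hxb⟩

theorem SigmaInjective.of_injOn {X W : Type*} [MeasurableSpace X] {f : X → W} {S : Set X}
    (hS : MeasurableSet S) (h : InjOn f S) : SigmaInjective f S :=
  ⟨{S}, countable_singleton S, by simp [hS, h], by simp⟩

theorem SigmaInjective.union {X W : Type*} [MeasurableSpace X] {f : X → W} {S T : Set X}
    (hS : SigmaInjective f S) (hT : SigmaInjective f T) : SigmaInjective f (S ∪ T) := by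
  rw [union_eq_iUnion]
  exact SigmaInjective.iUnion (by rintro (_ | _) <;> assumption)

/-! ### Borel envelopes and removal of the σ-injective part -/

section Polish

variable {X W : Type*} [TopologicalSpace X] [PolishSpace X] [MeasurableSpace X] [BorelSpace X]
  [TopologicalSpace W] [PolishSpace W] {f : X → W}

/-- The points outside the diagonal that share their value under `f` with a point of an analytic
set form an analytic set. -/
theorem analyticSet_exists_ne_of_eq {X W : Type*} [TopologicalSpace X] [PolishSpace X]
    [TopologicalSpace W] [PolishSpace W] {f : X → W} (hf : Continuous f) {A : Set X} (hA : AnalyticSet A) :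
    AnalyticSet {x | ∃ a ∈ A, x ≠ a ∧ f x = f a} := by
  have h1 : AnalyticSet {p : X × X | p.2 ∈ A} := hA.preimage continuous_snd
  have h2 : AnalyticSet {p : X × X | p.1 ≠ p.2} := by
    borelize (X × X)
    exact (isOpen_ne_fun continuous_fst continuous_snd).measurableSet.analyticSet
  have h3 : AnalyticSet {p : X × X | f p.1 = f p.2} :=
    (isClosed_eq (hf.comp continuous_fst) (hf.comp continuous_snd)).analyticSet
  have h4 := AnalyticSet.iInter (s := fun i : Fin 3 => (![{p : X × X | p.2 ∈ A},
    {p : X × X | p.1 ≠ p.2}, {p : X × X | f p.1 = f p.2}] i)) (by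
      intro i
      fin_cases i
      · exact h1
      · exact h2
      · exact h3)
  convert h4.image_of_continuous continuous_fst using 1
  ext x
  simp [Fin.forall_fin_succ, and_assoc]

/-- An analytic set on which `f` is injective is contained in a Borel set on which `f` is
injective. -/
theorem exists_measurableSet_injOn (hf : Continuous f) {A : Set X} (hA : AnalyticSet A)
    (hinj : InjOn f A) : ∃ B, MeasurableSet B ∧ A ⊆ B ∧ InjOn f B := by
  -- One separation only prevents collisions between `B₀` and `A`. It does make `A` disjoint from
  -- the points colliding with `B₀`, so a second separation removes collisions inside `B₀` itself.
  obtain ⟨B₀, hAB₀, hd₀, hB₀⟩ := hA.measurablySeparable (analyticSet_exists_ne_of_eq hf hA) (by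
    rw [Set.disjoint_left]
    rintro x hx ⟨a, ha, hne, he⟩
    exact hne (hinj hx ha he))
  obtain ⟨B₁, hAB₁, hd₁, hB₁⟩ :=
    hA.measurablySeparable (analyticSet_exists_ne_of_eq hf hB₀.analyticSet) (by
      rw [Set.disjoint_left]
      rintro x hx ⟨b, hb, hne, he⟩
      exact Set.disjoint_left.1 hd₀ ⟨x, hx, hne.symm, he.symm⟩ hb)
  refine ⟨B₀ ∩ B₁, hB₀.inter hB₁, subset_inter hAB₀ hAB₁, fun x hx y hy he => ?_⟩
  by_contra hne
  exact Set.disjoint_left.1 hd₁ ⟨y, hy.1, hne, he⟩ hx.2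

/-- The points of `U ∩ G` whose fiber meets `V ∩ G` for all `V ∈ L`. -/
def fiberMeeting (f : X → W) (G : Set X) (L : List (Set X)) (U : Set X) : Set X :=
  {x | x ∈ U ∩ G ∧ ∀ V ∈ L, f x ∈ f '' (V ∩ G)}

theorem fiberMeeting_mono {X W : Type*} {f : X → W} {G G' : Set X} (h : G ⊆ G') (L : List (Set X)) (U : Set X) :
    fiberMeeting f G L U ⊆ fiberMeeting f G' L U := fun _ hx =>
  ⟨⟨hx.1.1, h hx.1.2⟩, fun V hV => image_mono (inter_subset_inter_right V h) (hx.2 V hV)⟩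

theorem analyticSet_fiberMeeting (hf : Continuous f) {G : Set X} (hG : MeasurableSet G)
    {L : List (Set X)} (hL : ∀ V ∈ L, MeasurableSet V) {U : Set X} (hU : MeasurableSet U) :
    AnalyticSet (fiberMeeting f G L U) := by
  have h : AnalyticSet (⋂ o : Option {V // V ∈ L},
      o.elim (U ∩ G) fun V => f ⁻¹' (f '' (V.1 ∩ G))) := by
    have : Countable {V // V ∈ L} := (List.finite_toSet L).to_subtype.to_countable
    refine AnalyticSet.iInter fun o => ?_
    rcases o with _ | V
    · exact (hU.inter hG).analyticSet
    · exact (((hL V.1 V.2).inter hG).analyticSet.image_of_continuous hf).preimage hf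
  convert h using 1
  ext x
  simp only [fiberMeeting, mem_ofPred_eq, mem_iInter, Option.forall, Option.elim, Subtype.forall,
    mem_preimage]

/-- There is a Borel set with `SigmaInjective` complement in which no nonempty set
`fiberMeeting f G L U` of basic open sets consists of points of different fibers. -/
theorem exists_measurableSet_not_injOn (hf : Continuous f) {b : Set (Set X)} (hb : b.Countable)
    (hbo : ∀ V ∈ b, IsOpen V) :
    ∃ G, MeasurableSet G ∧ SigmaInjective f Gᶜ ∧ ∀ L : List (Set X), (∀ V ∈ L, V ∈ b) →
      ∀ U ∈ b, (fiberMeeting f G L U).Nonempty → ¬ InjOn f (fiberMeeting f G L U) := by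
  have : Countable b := hb.to_subtype
  let A (G : Set X) (c : List b × b) : Set X := fiberMeeting f G (c.1.map (↑)) c.2
  have hAm {G G' : Set X} (h : G ⊆ G') (c) : A G c ⊆ A G' c := fiberMeeting_mono h _ _
  have hA {G : Set X} (hG : MeasurableSet G) (c) : AnalyticSet (A G c) := by
    refine analyticSet_fiberMeeting hf hG (fun V hV => ?_) (hbo _ c.2.2).measurableSet
    obtain ⟨V', -, rfl⟩ := List.mem_map.1 hV
    exact (hbo _ V'.2).measurableSet
  -- If some co-σ-injective Borel set makes `A _ c` a set of injectivity, `G₀ c` is one; smaller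
  -- sets inherit this. The intersection over the countably many `c` thus handles all of them at
  -- once.
  have h1 : ∀ c, ∃ G, (MeasurableSet G ∧ SigmaInjective f Gᶜ) ∧
      ∀ G', MeasurableSet G' → SigmaInjective f G'ᶜ → InjOn f (A G' c) → InjOn f (A G c) := by
    intro c
    by_cases h : ∃ G', (MeasurableSet G' ∧ SigmaInjective f G'ᶜ) ∧ InjOn f (A G' c)
    · obtain ⟨G', h1, h2⟩ := h
      exact ⟨G', h1, fun _ _ _ _ => h2⟩
    · refine ⟨univ, ⟨MeasurableSet.univ, ∅, countable_empty, by simp, by simp⟩, ?_⟩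
      intro G' h1 h2 h3
      exact absurd ⟨G', ⟨h1, h2⟩, h3⟩ h
  choose G₀ hG₀ hG₀i using h1
  have hI : MeasurableSet (⋂ c, G₀ c) := MeasurableSet.iInter fun c => (hG₀ c).1
  have h2 : ∀ c, ∃ H, MeasurableSet H ∧ InjOn f H ∧
      (InjOn f (A (⋂ c, G₀ c) c) → A (⋂ c, G₀ c) c ⊆ H) := by
    intro c
    by_cases h : InjOn f (A (⋂ c, G₀ c) c)
    · obtain ⟨H, h1, h2, h3⟩ := exists_measurableSet_injOn hf (hA hI c) h
      exact ⟨H, h1, h3, fun _ => h2⟩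
    · exact ⟨∅, MeasurableSet.empty, injOn_empty f, fun h' => absurd h' h⟩
  choose H hHm hHi hH using h2
  have hGm : MeasurableSet ((⋂ c, G₀ c) \ ⋃ c, H c) := hI.diff (MeasurableSet.iUnion hHm)
  have hGs : SigmaInjective f ((⋂ c, G₀ c) \ ⋃ c, H c)ᶜ := by
    refine ((SigmaInjective.iUnion fun c => (hG₀ c).2).union
      (SigmaInjective.iUnion fun c => SigmaInjective.of_injOn (hHm c) (hHi c))).mono ?_
    intro x hx
    by_contra h
    simp only [mem_union, mem_iUnion, mem_compl_iff, not_or, not_exists, not_not] at h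
    exact hx ⟨mem_iInter.2 h.1, by simpa using h.2⟩
  refine ⟨_, hGm, hGs, fun L hL U hU hne hinj => ?_⟩
  obtain ⟨L', rfl⟩ : ∃ L' : List b, L'.map (↑) = L := by
    lift L to List b using hL
    exact ⟨L, rfl⟩
  obtain ⟨x, hx⟩ := hne
  -- Injectivity for the final set would pass to `⋂ c, G₀ c`, so `x` would lie in one of the deleted
  -- envelopes `H c`.
  have h3 : InjOn f (A (⋂ c, G₀ c) (L', ⟨U, hU⟩)) :=
    (hG₀i (L', ⟨U, hU⟩) _ hGm hGs hinj).mono (hAm (iInter_subset _ _) _)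
  exact hx.1.2.2 (mem_iUnion.2 ⟨_, hH _ h3 (hAm sdiff_subset (L', ⟨U, hU⟩) hx)⟩)

end Polish

/-! ### Splitting points within a fiber -/

section Splitting

variable {X W : Type*} [TopologicalSpace X] {f : X → W} {G : Set X}

/-- Whenever finitely many open sets are met by one fiber of the restriction of `f` to `G`, any one
of them contains two points of a fiber that meets all of them. -/
def FibersSplit (f : X → W) (G : Set X) : Prop :=
  ∀ (ι : Type) [Finite ι] (U : ι → Set X) (p : ι → X) (y : W) (i₀ : ι), (∀ i, IsOpen (U i)) →
    (∀ i, p i ∈ U i ∩ G ∧ f (p i) = y) →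
    ∃ (q : ι → X) (r : X) (z : W), (∀ i, q i ∈ U i ∩ G ∧ f (q i) = z) ∧ r ∈ U i₀ ∩ G ∧ f r = z ∧
      r ≠ q i₀

theorem exists_fibersSplit [PolishSpace X] [MeasurableSpace X] [BorelSpace X]
    [TopologicalSpace W] [PolishSpace W] (hf : Continuous f) :
    ∃ G, SigmaInjective f Gᶜ ∧ FibersSplit f G := by
  obtain ⟨G, -, hGs, hG⟩ := exists_measurableSet_not_injOn hf
    (TopologicalSpace.countable_countableBasis X)
    (fun V hV => TopologicalSpace.isOpen_of_mem_countableBasis hV)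
  refine ⟨G, hGs, ?_⟩
  intro ι _ U p y i₀ hU hp
  have := Fintype.ofFinite ι
  have hV : ∀ i, ∃ V ∈ TopologicalSpace.countableBasis X, p i ∈ V ∧ V ⊆ U i := fun i =>
    (TopologicalSpace.isBasis_countableBasis X).exists_subset_of_mem_open (hp i).1.1 (hU i)
  choose V hVb hpV hVU using hV
  have h := hG (Finset.univ.toList.map V) (by simpa using hVb) (V i₀) (hVb i₀)
    ⟨p i₀, ⟨hpV i₀, (hp i₀).1.2⟩, by
      simp only [List.mem_map, Finset.mem_toList, Finset.mem_univ, true_and, forall_exists_index,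
        forall_apply_eq_imp_iff]
      exact fun i => ⟨p i, ⟨hpV i, (hp i).1.2⟩, (hp i).2.trans (hp i₀).2.symm⟩⟩
  simp only [InjOn, not_forall] at h
  obtain ⟨x, hx, r, hr, he, hne⟩ := h
  have hx2 : ∀ i, ∃ q, q ∈ V i ∩ G ∧ f q = f x := fun i =>
    hx.2 (V i) (List.mem_map.2 ⟨i, by simp, rfl⟩)
  choose q hq hqx using hx2
  classical
  refine ⟨Function.update q i₀ x, r, f x, fun i => ?_, ⟨hVU _ hr.1.1, hr.1.2⟩, he.symm, ?_⟩
  · by_cases hi : i = i₀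
    · subst hi
      simpa using ⟨hVU _ hx.1.1, hx.1.2⟩
    · simpa [hi] using ⟨⟨hVU _ (hq i).1, (hq i).2⟩, hqx i⟩
  · simpa using Ne.symm hne

/-- Indices are split one at a time, by applying `FibersSplit` to the doubled family indexed by
`Bool × ι`. Pairs already split are first enclosed in disjoint open sets, so they stay distinct when
the fiber changes. -/
theorem FibersSplit.exists_pair [T2Space X] (hG : FibersSplit f G) {ι : Type} [Finite ι]
    {U : ι → Set X} {p : ι → X} {y : W} (hU : ∀ i, IsOpen (U i))
    (hp : ∀ i, p i ∈ U i ∩ G ∧ f (p i) = y) :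
    ∃ (q : Bool → ι → X) (z : W), (∀ b i, q b i ∈ U i ∩ G ∧ f (q b i) = z) ∧
      ∀ i, q true i ≠ q false i := by
  classical
  have := Fintype.ofFinite ι
  suffices ∀ S : Finset ι, ∃ (q : Bool → ι → X) (z : W),
      (∀ b i, q b i ∈ U i ∩ G ∧ f (q b i) = z) ∧ ∀ i ∈ S, q true i ≠ q false i by
    obtain ⟨q, z, h1, h2⟩ := this Finset.univ
    exact ⟨q, z, h1, fun i => h2 i (Finset.mem_univ i)⟩
  intro S
  induction S using Finset.induction_on with
  | empty => exact ⟨fun _ => p, y, fun _ => hp, by simp⟩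
  | insert i₀ S _ ih =>
    obtain ⟨q, z, hq, hne⟩ := ih
    have hV : ∀ i, ∃ V : Bool → Set X, (∀ b, IsOpen (V b) ∧ q b i ∈ V b) ∧
        (i ∈ S → Disjoint (V true) (V false)) := by
      intro i
      by_cases hi : i ∈ S
      · obtain ⟨u, v, hu, hv, h1, h2, h3⟩ := t2_separation (hne i hi)
        exact ⟨fun b => cond b u v, by rintro (_ | _) <;> simp [*], fun _ => h3⟩
      · exact ⟨fun _ => univ, by simp, fun h => absurd h hi⟩
    choose V hV hVd using hV
    obtain ⟨q', r, z', hq', hr, hrz, hrne⟩ := hG (Bool × ι) (fun c => U c.2 ∩ V c.2 c.1)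
      (fun c => q c.1 c.2) z (true, i₀) (fun c => (hU c.2).inter (hV c.2 c.1).1)
      (fun c => ⟨⟨⟨(hq c.1 c.2).1.1, (hV c.2 c.1).2⟩, (hq c.1 c.2).1.2⟩, (hq c.1 c.2).2⟩)
    refine ⟨fun b i => if b = false ∧ i = i₀ then r else q' (b, i), z', fun b i => ?_,
      fun i hi => ?_⟩
    · dsimp only
      split_ifs with h
      · rw [h.2]
        exact ⟨⟨hr.1.1, hr.2⟩, hrz⟩
      · exact ⟨⟨(hq' (b, i)).1.1.1, (hq' (b, i)).1.2⟩, (hq' (b, i)).2⟩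
    · by_cases h : i = i₀
      · subst h
        simpa using hrne.symm
      · have hiS : i ∈ S := (Finset.mem_insert.1 hi).resolve_left h
        simpa [h] using (hVd i hiS).ne_of_mem (hq' (true, i)).1.1.2 (hq' (false, i)).1.1.2

end Splitting

/-! ### A Cantor scheme inside one fiber -/

section Scheme

variable {X W : Type*} [MetricSpace X] {f : X → W} {G : Set X}

/-- The sets `U l` with `l` of length `n` are open and met by a common fiber of `f` on `G`. -/
def IsLevel (f : X → W) (G : Set X) (n : ℕ) (U : List Bool → Set X) : Prop :=
  ∃ (p : List Bool → X) (y : W), ∀ l, l.length = n → IsOpen (U l) ∧ p l ∈ U l ∩ G ∧ f (p l) = y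

theorem IsLevel.exists_succ (hG : FibersSplit f G) {n : ℕ} {U : List Bool → Set X}
    (hU : IsLevel f G n U) {ε : ℝ} (hε : 0 < ε) :
    ∃ V, IsLevel f G (n + 1) V ∧ ∀ l, l.length = n →
      (∀ b, closure (V (b :: l)) ⊆ U l ∧ Metric.ediam (V (b :: l)) ≤ ENNReal.ofReal (2 * ε)) ∧
      Disjoint (V (true :: l)) (V (false :: l)) := by
  obtain ⟨p, y, hp⟩ := hU
  obtain ⟨q, z, hq, hne⟩ := hG.exists_pair (ι := List.Vector Bool n) (U := fun l => U l.1)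
    (p := fun l => p l.1) (y := y) (fun l => (hp l.1 l.2).1) (fun l => (hp l.1 l.2).2)
  have hr : ∀ l : List.Vector Bool n, ∃ r : ℝ, 0 < r ∧ r ≤ ε ∧
      (∀ b, Metric.closedBall (q b l) r ⊆ U l.1) ∧ r + r ≤ dist (q true l) (q false l) := by
    intro l
    have h1 : ∀ b, ∃ r : ℝ, 0 < r ∧ Metric.closedBall (q b l) r ⊆ U l.1 := fun b =>
      Metric.nhds_basis_closedBall.mem_iff.1 ((hp l.1 l.2).1.mem_nhds (hq b l).1.1)
    choose r hr hrU using h1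
    have hd := dist_pos.2 (hne l)
    refine ⟨min (min (r true) (r false)) (min ε (dist (q true l) (q false l) / 2)), ?_, ?_, ?_, ?_⟩
    · exact lt_min (lt_min (hr _) (hr _)) (lt_min hε (by linarith))
    · exact (min_le_right _ _).trans (min_le_left _ _)
    · rintro (_ | _)
      · exact (Metric.closedBall_subset_closedBall
          ((min_le_left _ _).trans (min_le_right _ _))).trans (hrU _)
      · exact (Metric.closedBall_subset_closedBall
          ((min_le_left _ _).trans (min_le_left _ _))).trans (hrU _)
    · have := (min_le_right (min (r true) (r false)) _).trans
        (min_le_right ε (dist (q true l) (q false l) / 2))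
      linarith
  choose r hr0 hrε hrU hrd using hr
  -- Only lists of length `n + 1` matter; the head selects a point of the pair over the tail, and
  -- the other values are placeholders.
  let c (l : List Bool) : X := if h : l.tail.length = n then q (l.headD true) ⟨l.tail, h⟩ else p []
  let V (l : List Bool) : Set X :=
    if h : l.tail.length = n then Metric.ball (c l) (r ⟨l.tail, h⟩) else ∅
  have hV : ∀ b l (h : l.length = n), V (b :: l) = Metric.ball (q b ⟨l, h⟩) (r ⟨l, h⟩) := by
    intro b l h
    simp [V, c, h]
  refine ⟨V, ⟨c, z, fun l hl => ?_⟩, fun l hl => ⟨fun b => ⟨?_, ?_⟩, ?_⟩⟩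
  · rcases l with _ | ⟨b, l⟩
    · simp at hl
    · have h : l.length = n := by simpa using hl
      rw [hV b l h]
      have hc : c (b :: l) = q b ⟨l, h⟩ := by simp [c, h]
      rw [hc]
      exact ⟨Metric.isOpen_ball, ⟨Metric.mem_ball_self (hr0 _), (hq b ⟨l, h⟩).1.2⟩,
        (hq b ⟨l, h⟩).2⟩
  · rw [hV b l hl]
    exact Metric.closure_ball_subset_closedBall.trans (hrU ⟨l, hl⟩ b)
  · rw [hV b l hl]
    refine Metric.ediam_le fun x hx y hy => ?_
    rw [edist_dist]
    apply ENNReal.ofReal_le_ofReal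
    have := dist_triangle_right x y (q b ⟨l, hl⟩)
    rw [Metric.mem_ball] at hx hy
    linarith [hrε ⟨l, hl⟩]
  · rw [hV _ l hl, hV _ l hl]
    exact Metric.ball_disjoint_ball (hrd ⟨l, hl⟩)

/-- At each level the witnesses `p n l` share one value `y n`, whatever the branch. Along a branch
they converge to its limit point, so by continuity all limit points have the value `lim y n`. -/
theorem FibersSplit.exists_not_countable_fiber [CompleteSpace X] [TopologicalSpace W] [T2Space W]
    (hf : Continuous f) (hG : FibersSplit f G) (hne : G.Nonempty) :
    ∃ y, ¬ (f ⁻¹' {y}).Countable := by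
  obtain ⟨x₀, hx₀⟩ := hne
  have h0 : IsLevel f G 0 fun _ => univ :=
    ⟨fun _ => x₀, f x₀, fun _ _ => ⟨isOpen_univ, ⟨mem_univ _, hx₀⟩, rfl⟩⟩
  choose next hnext hspec using fun (n : ℕ) (U : {U // IsLevel f G n U}) =>
    U.2.exists_succ hG (ε := 1 / ((n : ℝ) + 1)) (by positivity)
  let S : ∀ n, {U // IsLevel f G n U} := fun n =>
    Nat.rec ⟨_, h0⟩ (fun n U => ⟨next n U, hnext n U⟩) n
  let A : List Bool → Set X := fun l => (S l.length).1 l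
  have hstep : ∀ l : List Bool,
      (∀ b, closure (A (b :: l)) ⊆ A l ∧
        Metric.ediam (A (b :: l)) ≤ ENNReal.ofReal (2 * (1 / ((l.length : ℝ) + 1)))) ∧
      Disjoint (A (true :: l)) (A (false :: l)) := fun l => hspec l.length (S l.length) l rfl
  have hanti : CantorScheme.ClosureAntitone A := fun l b => ((hstep l).1 b).1
  have hdisj : CantorScheme.Disjoint A := by
    rintro l (_ | _) (_ | _) h
    · exact absurd rfl h
    · exact (hstep l).2.symm
    · exact (hstep l).2
    · exact absurd rfl h
  have hdiam : CantorScheme.VanishingDiam A := by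
    intro x
    -- Level `0` is the whole space; diameters are bounded only from level `1` on.
    rw [← tendsto_add_atTop_iff_nat 1]
    have hlim : Tendsto (fun n : ℕ => ENNReal.ofReal (2 * (1 / ((n : ℝ) + 1)))) atTop (𝓝 0) := by
      have := (tendsto_one_div_add_atTop_nhds_zero_nat (𝕜 := ℝ)).const_mul 2
      simpa using ENNReal.tendsto_ofReal this
    refine tendsto_of_tendsto_of_tendsto_of_le_of_le tendsto_const_nhds hlim
      (fun _ => zero_le) fun n => ?_
    have := ((hstep (PiNat.res x n)).1 (x n)).2
    rwa [PiNat.res_length] at this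
  choose p y hp using fun n => (S n).2
  have hpA : ∀ l, p l.length l ∈ A l := fun l => (hp l.length l rfl).2.1.1
  have htotal := hanti.map_of_vanishingDiam hdiam fun l => ⟨_, hpA l⟩
  let g : (ℕ → Bool) → X := fun x => (CantorScheme.inducedMap A).2 ⟨x, by rw [htotal]; trivial⟩
  have hginj : Function.Injective g := fun x x' h => by
    simpa using hdisj.map_injective h
  have hgA : ∀ x n, g x ∈ A (PiNat.res x n) := fun x n => CantorScheme.map_mem _ n
  have hlim : ∀ x, Tendsto y atTop (𝓝 (f (g x))) := by
    intro x
    have h1 : Tendsto (fun n => p n (PiNat.res x n)) atTop (𝓝 (g x)) := by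
      rw [tendsto_iff_edist_tendsto_0]
      refine tendsto_of_tendsto_of_tendsto_of_le_of_le tendsto_const_nhds (hdiam x)
        (fun _ => zero_le) fun n => Metric.edist_le_ediam_of_mem ?_ (hgA x n)
      simpa using hpA (PiNat.res x n)
    refine ((hf.tendsto _).comp h1).congr fun n => ?_
    exact (hp n (PiNat.res x n) (PiNat.res_length x n)).2.2
  have huncount : Cardinal.aleph0 < Cardinal.mk (ℕ → Bool) := by
    simpa using Cardinal.cantor Cardinal.aleph0
  refine ⟨f (g fun _ => true), fun hc => ?_⟩
  have : Countable (f ⁻¹' {f (g fun _ => true)}) := hc.to_subtype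
  have hcount : Countable (ℕ → Bool) := Function.Injective.countable
    (f := fun x => (⟨g x, tendsto_nhds_unique (hlim x) (hlim _)⟩ : f ⁻¹' {f (g fun _ => true)}))
    fun x x' h => hginj (congrArg Subtype.val h)
  exact (Cardinal.mk_le_aleph0_iff.2 hcount).not_gt huncount

end Scheme

theorem Continuous.sigmaInjective_univ {X W : Type*} [TopologicalSpace X] [PolishSpace X]
    [MeasurableSpace X] [BorelSpace X] [TopologicalSpace W] [PolishSpace W] {f : X → W}
    (hf : Continuous f) (hc : ∀ y, (f ⁻¹' {y}).Countable) : SigmaInjective f univ := by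
  obtain ⟨G, hGs, hG⟩ := exists_fibersSplit hf
  let := TopologicalSpace.upgradeIsCompletelyMetrizable X
  rcases G.eq_empty_or_nonempty with rfl | hne
  · simpa using hGs
  · obtain ⟨y, hy⟩ := hG.exists_not_countable_fiber hf hne
    exact absurd (hc y) hy

/-- The **Lusin–Novikov theorem** for functions: a countable-to-one Borel map between standard Borel
spaces is injective on each of countably many Borel sets covering its domain. -/
theorem Measurable.sigmaInjective_univ {X W : Type*} [MeasurableSpace X] [StandardBorelSpace X]
    [MeasurableSpace W] [StandardBorelSpace W] {f : X → W} (hf : Measurable f)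
    (hc : ∀ y, (f ⁻¹' {y}).Countable) : SigmaInjective f univ := by
  obtain ⟨_, _, _⟩ := StandardBorelSpace.polish (α := W)
  obtain ⟨t, ht, htp⟩ := StandardBorelSpace.polish (α := X)
  -- A finer Polish topology with the same Borel sets makes `f` continuous.
  obtain ⟨t', hle, hft, htp'⟩ := hf.exists_continuous
  have hB : @BorelSpace X t' _ :=
    @BorelSpace.mk X t' _ (ht.measurable_eq.trans (borel_eq_borel_of_le htp' htp hle).symm)
  exact Continuous.sigmaInjective_univ hft hc

end LusinNovikov

/-! ### Borel numbering of countable fibers -/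

section Rank

open Set MeasureTheory

theorem exists_lt_count_eq (p : ℕ → Prop) [DecidablePred p] {N j : ℕ} (h : j < Nat.count p N) :
    ∃ k < N, p k ∧ Nat.count p k = j := by
  induction N with
  | zero => simp at h
  | succ N ih =>
    by_cases h' : j < Nat.count p N
    · obtain ⟨k, hk, hp⟩ := ih h'
      exact ⟨k, hk.trans N.lt_succ_self, hp⟩
    · rw [Nat.count_succ] at h
      split_ifs at h with hp
      · exact ⟨N, N.lt_succ_self, hp, by omega⟩
      · omega

/-- A lower set of natural numbers consists of the numbers smaller than its cardinality. -/
theorem IsLowerSet.mem_iff_lt_mk {J : Set ℕ} (hJ : IsLowerSet J) (j : ℕ) :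
    j ∈ J ↔ (j : Cardinal) < Cardinal.mk J := by
  by_cases h : J = univ
  · subst h
    simp
  · have h' : ∃ k, k ∉ J := by simpa [eq_univ_iff_forall] using h
    classical
    have : J = Iio (Nat.find h') := by
      ext i
      refine ⟨fun hi => ?_, fun hi => not_not.1 (Nat.find_min h' hi)⟩
      by_contra hlt
      exact Nat.find_spec h' (hJ (not_lt.1 hlt) hi)
    rw [this]
    simp

theorem Cardinal.eq_of_forall_natCast_lt_iff {a b : Cardinal.{u}} (ha : a ≤ Cardinal.aleph0)
    (hb : b ≤ Cardinal.aleph0) (h : ∀ j : ℕ, (j : Cardinal) < a ↔ (j : Cardinal) < b) : a = b := by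
  have key : ∀ {a b : Cardinal.{u}}, b ≤ Cardinal.aleph0 →
      (∀ j : ℕ, (j : Cardinal) < a ↔ (j : Cardinal) < b) → b ≤ a := by
    intro a b hb h
    by_contra hlt
    rw [not_le] at hlt
    obtain ⟨n, rfl⟩ := Cardinal.lt_aleph0.1 (hlt.trans_le hb)
    exact lt_irrefl _ ((h n).2 hlt)
  exact (key ha fun j => (h j).symm).antisymm (key hb h)

theorem Cardinal.mk_uLift_natCast_lt {m : Cardinal.{u}} (hm : m ≤ Cardinal.aleph0) :
    Cardinal.mk (ULift.{u} {j : ℕ // (j : Cardinal.{u}) < m}) = m := by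
  have hJ : IsLowerSet {j : ℕ | (j : Cardinal.{u}) < m} := fun a b hab ha =>
    lt_of_le_of_lt (b := (a : Cardinal.{u})) (Nat.cast_le.2 hab) ha
  refine Cardinal.eq_of_forall_natCast_lt_iff (Cardinal.mk_le_aleph0_iff.2 inferInstance) hm
    fun j => ?_
  rw [Cardinal.mk_uLift, Cardinal.nat_lt_lift_iff]
  exact (hJ.mem_iff_lt_mk j).symm

variable {X : Type u} {W : Type*} [MeasurableSpace X] [StandardBorelSpace X] [MeasurableSpace W]
  [StandardBorelSpace W] {f : X → W}

/-- Each point receives the index of the first set of injectivity containing it. -/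
theorem exists_measurable_nat_injective (hf : Measurable f) (hc : ∀ y, (f ⁻¹' {y}).Countable) :
    ∃ n : X → ℕ, Measurable n ∧ ∀ x y, f x = f y → n x = n y → x = y := by
  obtain ⟨B, hBc, hB, hcov⟩ := hf.sigmaInjective_univ hc
  rcases B.eq_empty_or_nonempty with rfl | hne
  · have h : ∀ x : X, False := fun x => by simpa using hcov (mem_univ x)
    exact ⟨fun _ => 0, measurable_const, fun x => (h x).elim⟩
  obtain ⟨b, rfl⟩ := hBc.exists_eq_range hne
  have hex : ∀ x, ∃ k, x ∈ b k := fun x => by simpa using hcov (mem_univ x)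
  classical
  refine ⟨fun x => Nat.find (hex x), measurable_find hex fun k => (hB _ ⟨k, rfl⟩).1,
    fun x y he hn => ?_⟩
  have hx := Nat.find_spec (hex x)
  dsimp only at hn
  rw [hn] at hx
  exact (hB _ ⟨_, rfl⟩).2 hx (Nat.find_spec (hex y)) he

/-- The points of each fiber of a countable-to-one Borel map can be numbered in a Borel way by an
initial segment of the natural numbers. -/
theorem exists_measurable_rank (hf : Measurable f) (hc : ∀ y, (f ⁻¹' {y}).Countable) :
    ∃ r : X → ℕ, Measurable r ∧ (∀ x y, f x = f y → r x = r y → x = y) ∧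
      ∀ w (j : ℕ), (∃ y, f y = w ∧ r y = j) ↔
        (j : Cardinal.{u}) < Cardinal.mk {y // f y = w} := by
  obtain ⟨n, hn, hinj⟩ := exists_measurable_nat_injective hf hc
  classical
  -- By Lusin–Souslin: `f` is injective on each level of `n`.
  have hD : ∀ k, MeasurableSet (f '' (n ⁻¹' {k})) := fun k =>
    (hn (measurableSet_singleton k)).image_of_measurable_injOn hf fun x hx y hy he =>
      hinj x y he (Eq.trans hx (Eq.symm hy))
  -- Counting the labels below `k` that occur over `w` closes the gaps in the labels of each fiber.
  let c (w : W) (k : ℕ) : ℕ := Nat.count (fun k => w ∈ f '' (n ⁻¹' {k})) k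
  have hcm : Measurable fun p : W × ℕ => c p.1 p.2 := by
    refine measurable_from_prod_countable_left fun k => ?_
    induction k with
    | zero => simp [c]
    | succ k ih =>
      simp only [c, Nat.count_succ] at ih ⊢
      exact ih.add (Measurable.ite (hD k) measurable_const measurable_const)
  have hmem : ∀ x, f x ∈ f '' (n ⁻¹' {n x}) := fun x => ⟨x, rfl, rfl⟩
  have hr : ∀ x y, f x = f y → c (f x) (n x) = c (f y) (n y) → x = y := by
    intro x y he h
    refine hinj x y he (Nat.count_injective (p := fun k => f y ∈ f '' (n ⁻¹' {k})) ?_ (hmem y) ?_)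
    · have := hmem x
      rwa [he] at this
    · rwa [he] at h
  refine ⟨fun x => c (f x) (n x), hcm.comp (hf.prodMk hn), hr, fun w j => ?_⟩
  have hJ : IsLowerSet {j | ∃ y, f y = w ∧ c (f y) (n y) = j} := by
    rintro a b hab ⟨y, hy, rfl⟩
    rcases hab.eq_or_lt with rfl | hlt
    · exact ⟨y, hy, rfl⟩
    · obtain ⟨k, -, ⟨x, hx, he⟩, hk⟩ := exists_lt_count_eq _ hlt
      refine ⟨x, he.trans hy, ?_⟩
      rw [he, show n x = k from hx]
      exact hk
  have hcard : Cardinal.lift.{0} (Cardinal.mk {y // f y = w}) =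
      Cardinal.lift.{u} (Cardinal.mk {j | ∃ y, f y = w ∧ c (f y) (n y) = j}) := by
    refine Cardinal.lift_mk_eq'.2 ⟨Equiv.ofBijective
      (fun y => ⟨c (f y.1) (n y.1), y.1, y.2, rfl⟩) ⟨fun x y h => ?_, ?_⟩⟩
    · exact Subtype.ext (hr _ _ (x.2.trans y.2.symm) (congrArg Subtype.val h))
    · rintro ⟨_, y, hy, rfl⟩
      exact ⟨⟨y, hy⟩, rfl⟩
  rw [Cardinal.lift_uzero] at hcard
  rw [hcard, Cardinal.nat_lt_lift_iff]
  exact hJ.mem_iff_lt_mk j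

theorem Measurable.exists_measurableEquiv_of_bijective {A B : Type*} [MeasurableSpace A]
    [StandardBorelSpace A] [MeasurableSpace B] [StandardBorelSpace B] {φ : A → B}
    (hm : Measurable φ) (hb : Function.Bijective φ) : ∃ e : A ≃ᵐ B, ∀ a, e a = φ a := by
  have he := hm.measurableEmbedding hb.1
  refine ⟨⟨Equiv.ofBijective φ hb, hm, fun s hs => ?_⟩, fun _ => rfl⟩
  rw [← Equiv.image_eq_preimage_symm]
  exact he.measurableSet_image.2 hs

theorem MeasurableEquiv.standardBorelSpace {A B : Type*} [MeasurableSpace A]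
    [MeasurableSpace B] [StandardBorelSpace B] (e : A ≃ᵐ B) : StandardBorelSpace A := by
  obtain ⟨t, _, _⟩ := StandardBorelSpace.polish (α := B)
  let := t.induced e
  have : PolishSpace A := e.toEquiv.polishSpace_induced
  have : BorelSpace A := e.measurableEmbedding.borelSpace ⟨rfl⟩
  infer_instance

instance ULift.standardBorelSpace {A : Type*} [MeasurableSpace A] [StandardBorelSpace A] :
    StandardBorelSpace (ULift A) :=
  MeasurableEquiv.ulift.standardBorelSpace

/-- The union of the fibers of cardinality `m` of a countable-to-one Borel map is Borel isomorphic
to a product over the base. -/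
theorem exists_parametrization_fibers (hf : Measurable f) (hc : ∀ y, (f ⁻¹' {y}).Countable)
    {m : Cardinal.{u}} (hm : m ≤ Cardinal.aleph0) :
    ∃ (Z : Set W) (_ : StandardBorelSpace Z)
      (ψ : Z × ULift.{u} {j : ℕ // (j : Cardinal.{u}) < m} → X), Measurable ψ ∧
      Function.Injective ψ ∧ range ψ = {x | Cardinal.mk {y // f y = f x} = m} ∧
      ∀ p, f (ψ p) = p.1 := by
  obtain ⟨r, hr, hinj, hcard⟩ := exists_measurable_rank hf hc
  have hle : ∀ w, Cardinal.mk {y // f y = w} ≤ Cardinal.aleph0 := fun w =>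
    Cardinal.mk_le_aleph0_iff.2 (hc w).to_subtype
  -- Having size `m` becomes a countable conjunction of Borel conditions: exactly the ranks below
  -- `m` occur over `w`.
  have hiff : ∀ w, Cardinal.mk {y // f y = w} = m ↔
      ∀ j : ℕ, w ∈ f '' (r ⁻¹' {j}) ↔ (j : Cardinal.{u}) < m := by
    intro w
    have h : ∀ j : ℕ, w ∈ f '' (r ⁻¹' {j}) ↔ (j : Cardinal.{u}) < Cardinal.mk {y // f y = w} := by
      intro j
      rw [← hcard w j]
      simp [and_comm]
    simp only [h]
    exact ⟨fun h j => by rw [h], Cardinal.eq_of_forall_natCast_lt_iff (hle w) hm⟩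
  have hD : ∀ j, MeasurableSet (f '' (r ⁻¹' {j})) := fun j =>
    (hr (measurableSet_singleton j)).image_of_measurable_injOn hf fun x hx y hy he =>
      hinj x y he (Eq.trans hx (Eq.symm hy))
  have hZ : MeasurableSet {w | Cardinal.mk {y // f y = w} = m} := by
    simp only [hiff]
    rw [ofPred_forall]
    refine MeasurableSet.iInter fun j => ?_
    by_cases hj : (j : Cardinal.{u}) < m
    · simp only [hj, iff_true]
      exact hD j
    · simp only [hj, iff_false]
      exact (hD j).compl
  have hX : MeasurableSet {x | Cardinal.mk {y // f y = f x} = m} := hf hZ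
  have := hZ.standardBorel
  have := hX.standardBorel
  let φ : {x | Cardinal.mk {y // f y = f x} = m} → {w | Cardinal.mk {y // f y = w} = m} ×
      ULift.{u} {j : ℕ // (j : Cardinal.{u}) < m} := fun x =>
    (⟨f x, x.2⟩, ⟨⟨r x, by
      have h := (hcard (f x) (r x)).1 ⟨x, rfl, rfl⟩
      rwa [show Cardinal.mk {y // f y = f x} = m from x.2] at h⟩⟩)
  have hφ : Measurable φ :=
    ((hf.comp measurable_subtype_coe).subtype_mk).prodMk
      (measurable_up.comp (hr.comp measurable_subtype_coe).subtype_mk)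
  have hφb : Function.Bijective φ := by
    refine ⟨fun x y h => Subtype.ext (hinj _ _ ?_ ?_), ?_⟩
    · exact congrArg (fun p => (p.1 : W)) h
    · exact congrArg (fun p => (p.2.down : ℕ)) h
    · rintro ⟨⟨w, hw⟩, ⟨⟨j, hj⟩⟩⟩
      obtain ⟨x, rfl, rfl⟩ := (hcard w j).2 (by rwa [show Cardinal.mk {y // f y = w} = m from hw])
      exact ⟨⟨x, hw⟩, rfl⟩
  obtain ⟨e, he⟩ := hφ.exists_measurableEquiv_of_bijective hφb
  refine ⟨_, hZ.standardBorel, fun p => e.symm p, measurable_subtype_coe.comp e.symm.measurable,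
    Subtype.val_injective.comp e.symm.injective, ?_, fun p => ?_⟩
  · ext x
    constructor
    · rintro ⟨p, rfl⟩
      exact (e.symm p).2
    · exact fun hx => ⟨e ⟨x, hx⟩, by simp⟩
  · have h := he (e.symm p)
    rw [MeasurableEquiv.apply_symm_apply] at h
    exact (congrArg (fun p => (p.1 : W)) h).symm

end Rank

/-! ### The normal form and the fine shape -/

section Parametrization

open Set MeasureTheory

namespace BorelER

instance CPlus.countable : Countable CPlus.{u} := by
  refine Set.Countable.to_subtype (((countable_range fun n : ℕ => (n : Cardinal.{u})).union
    (Set.toFinite {Cardinal.aleph0, Cardinal.continuum}).countable).mono ?_)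
  rintro m ⟨-, hm | hm⟩
  · rcases hm.lt_or_eq with h | h
    · obtain ⟨n, rfl⟩ := Cardinal.lt_aleph0.1 h
      exact Or.inl ⟨n, rfl⟩
    · exact Or.inr (Or.inl h)
  · exact Or.inr (Or.inr hm)

variable {X : Type u} [MeasurableSpace X] {E : Setoid X}

theorem IsSmooth.measurableSet_class (hE : IsSmooth E) (x : X) : MeasurableSet {y | E y x} := by
  obtain ⟨W, _, _, f, hf, h⟩ := hE
  convert hf (measurableSet_singleton (f x)) using 1
  ext y
  exact h y x

/-- The points whose class is countable form a Borel set. -/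
theorem IsSmooth.measurableSet_countable_class (hE : IsSmooth E)
    (hc : CountablyManyUncountableClasses E) : MeasurableSet {x | {y | E y x}.Countable} := by
  -- The complement is a countable union of classes, each a preimage of a point under the reduction.
  have h : {x | {y | E y x}.Countable}ᶜ = ⋃₀ {C : Set X | C ∈ E.classes ∧ ¬ C.Countable} := by
    ext x
    constructor
    · exact fun hx => ⟨_, ⟨⟨x, rfl⟩, hx⟩, E.refl x⟩
    · rintro ⟨_, ⟨⟨y, rfl⟩, hy⟩, hxy⟩ hx
      exact hy (hx.mono fun z hz => E.trans hz (E.symm hxy))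
  rw [← MeasurableSet.compl_iff, h]
  refine MeasurableSet.sUnion hc ?_
  rintro _ ⟨⟨x, rfl⟩, -⟩
  exact hE.measurableSet_class x

theorem mk_eq_continuum {A : Type u} [MeasurableSpace A] [StandardBorelSpace A]
    (h : ¬ Countable A) : Cardinal.mk A = Cardinal.continuum := by
  have := Cardinal.mk_congr
    ((PolishSpace.measurableEquivNatBoolOfNotCountable h).toEquiv.trans Equiv.ulift.{u}.symm)
  rw [this]
  simp

variable [StandardBorelSpace X]

theorem IsSmooth.mk_class_mem_CPlus (hE : IsSmooth E) (x : X) :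
    Cardinal.mk {y // E y x} ∈ CPlus := by
  refine ⟨Cardinal.mk_ne_zero_iff.2 ⟨⟨x, E.refl x⟩⟩, ?_⟩
  by_cases h : Countable {y // E y x}
  · exact Or.inl (Cardinal.mk_le_aleph0_iff.2 h)
  · have := (hE.measurableSet_class x).standardBorel
    exact Or.inr (mk_eq_continuum (A := {y | E y x}) h)

/-- Restricted to the points with countable class, the reduction is countable-to-one and its fibers
are entire `E`-classes. -/
theorem IsSmooth.exists_parametrization_of_le_aleph0 (hE : IsSmooth E)
    (hc : CountablyManyUncountableClasses E) {m : Cardinal.{u}} (hm : m ≤ Cardinal.aleph0) :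
    ∃ (Z Y : Type u) (_ : MeasurableSpace Z) (_ : StandardBorelSpace Z) (_ : MeasurableSpace Y)
      (_ : StandardBorelSpace Y) (ψ : Z × Y → X), Cardinal.mk Y = m ∧ Measurable ψ ∧
      Function.Injective ψ ∧ range ψ = {x | Cardinal.mk {y // E y x} = m} ∧
      ∀ p q, E (ψ p) (ψ q) ↔ p.1 = q.1 := by
  have := (hE.measurableSet_countable_class hc).standardBorel
  obtain ⟨W, _, _, f, hf, h⟩ := hE
  replace h : ∀ x y, E x y ↔ f x = f y := h
  have hcard : ∀ x : {x | {y | E y x}.Countable},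
      Cardinal.mk {y : {x | {y | E y x}.Countable} // f y = f x} = Cardinal.mk {y // E y x} := by
    intro x
    refine Cardinal.mk_congr ⟨fun y => ⟨y.1, (h _ _).2 y.2⟩, fun y => ⟨⟨y.1, ?_⟩, (h _ _).1 y.2⟩,
      fun _ => rfl, fun _ => rfl⟩
    exact x.2.mono fun z hz => E.trans hz y.2
  obtain ⟨Z, hZ, ψ, hψ, hψi, hψr, hψf⟩ := exists_parametrization_fibers
    (f := fun x : {x | {y | E y x}.Countable} => f x) (hf.comp measurable_subtype_coe) (fun w => by
      rcases (((fun x : {x | {y | E y x}.Countable} => f x) ⁻¹' {w})).eq_empty_or_nonempty with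
        h0 | ⟨x, rfl⟩
      · rw [h0]
        exact countable_empty
      · have h1 : Countable {y // E y x} := x.2.to_subtype
        rw [← Cardinal.mk_le_aleph0_iff, ← hcard x, Cardinal.mk_le_aleph0_iff] at h1
        exact h1) hm
  refine ⟨Z, _, inferInstance, hZ, inferInstance, inferInstance, fun p => ψ p,
    Cardinal.mk_uLift_natCast_lt hm, measurable_subtype_coe.comp hψ,
    Subtype.val_injective.comp hψi, ?_, fun p q => ?_⟩
  · ext x
    constructor
    · rintro ⟨p, rfl⟩
      have h1 : ψ p ∈ range ψ := ⟨p, rfl⟩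
      rw [hψr] at h1
      exact (hcard _).symm.trans h1
    · intro hx
      have hx' : {y | E y x}.Countable := Cardinal.mk_le_aleph0_iff.1 (le_of_eq_of_le hx hm)
      have h1 : (⟨x, hx'⟩ : {x | {y | E y x}.Countable}) ∈ range ψ := by
        rw [hψr]
        exact (hcard _).trans hx
      obtain ⟨p, hp⟩ := h1
      exact ⟨p, congrArg Subtype.val hp⟩
  · rw [h, show f (ψ p) = p.1 from hψf p, show f (ψ q) = q.1 from hψf q, Subtype.coe_inj]

/-- The base is the countable discrete set of uncountable classes, so Borel isomorphisms of `ℝ` with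
the classes can be chosen separately and remain jointly Borel. -/
theorem IsSmooth.exists_parametrization_continuum (hE : IsSmooth E)
    (hc : CountablyManyUncountableClasses E) :
    ∃ (Z Y : Type u) (_ : MeasurableSpace Z) (_ : StandardBorelSpace Z) (_ : MeasurableSpace Y)
      (_ : StandardBorelSpace Y) (ψ : Z × Y → X), Cardinal.mk Y = Cardinal.continuum ∧
      Measurable ψ ∧ Function.Injective ψ ∧
      range ψ = {x | Cardinal.mk {y // E y x} = Cardinal.continuum} ∧
      ∀ p q, E (ψ p) (ψ q) ↔ p.1 = q.1 := by
  let Z := {C : Set X // C ∈ E.classes ∧ ¬ C.Countable}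
  have : Countable Z := Set.Countable.to_subtype hc
  let : MeasurableSpace Z := ⊤
  have : DiscreteMeasurableSpace Z := ⟨fun _ => trivial⟩
  have he : ∀ C : Z, ∃ ψ : ULift.{u} ℝ → X, Measurable ψ ∧ Function.Injective ψ ∧
      range ψ = C := by
    rintro ⟨_, ⟨x, rfl⟩, hC⟩
    have := (hE.measurableSet_class x).standardBorel
    have hR : ¬ Countable (ULift.{u} ℝ) := by
      rw [← Cardinal.mk_le_aleph0_iff]
      simpa [Cardinal.mk_real] using Cardinal.aleph0_lt_continuum
    let e : ULift.{u} ℝ ≃ᵐ {y | E y x} := PolishSpace.measurableEquivOfNotCountable hR hC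
    refine ⟨fun t => e t, measurable_subtype_coe.comp e.measurable,
      Subtype.val_injective.comp e.injective, ?_⟩
    ext y
    exact ⟨fun ⟨t, ht⟩ => ht ▸ (e t).2, fun hy => ⟨e.symm ⟨y, hy⟩, by simp⟩⟩
  choose ψ hψ hψi hψr using he
  have hmem : ∀ C t, ψ C t ∈ C.1 := fun C t => hψr C ▸ mem_range_self t
  have hE' : ∀ p q : Z × ULift.{u} ℝ, E (ψ p.1 p.2) (ψ q.1 q.2) ↔ p.1 = q.1 := by
    rintro ⟨C, s⟩ ⟨D, t⟩
    refine ⟨fun h => Subtype.ext ?_, fun h => ?_⟩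
    · obtain ⟨x, hx⟩ := C.2.1
      obtain ⟨y, hy⟩ := D.2.1
      have h1 := hmem C s
      have h2 := hmem D t
      rw [hx] at h1
      rw [hy] at h2
      have hxy : E x y := E.trans (E.symm h1) (E.trans h h2)
      rw [hx, hy]
      ext z
      exact ⟨fun hz => E.trans hz hxy, fun hz => E.trans hz (E.symm hxy)⟩
    · obtain rfl : C = D := h
      obtain ⟨x, hx⟩ := C.2.1
      have h1 := hmem C s
      have h2 := hmem C t
      rw [hx] at h1 h2
      exact E.trans h1 (E.symm h2)
  refine ⟨Z, ULift.{u} ℝ, inferInstance, inferInstance, inferInstance, inferInstance,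
    fun p => ψ p.1 p.2, by simp [Cardinal.mk_real], measurable_from_prod_countable_right hψ,
    fun p q h => ?_, ?_, hE'⟩
  · have h1 : p.1 = q.1 := (hE' p q).1 (by simp only at h; rw [h])
    refine Prod.ext h1 (hψi q.1 ?_)
    simpa only [h1] using h
  · have hunc : ∀ x, Cardinal.mk {y // E y x} = Cardinal.continuum ↔ ¬ {y | E y x}.Countable := by
      intro x
      constructor
      · intro h h'
        exact (Cardinal.mk_le_aleph0_iff.2 h'.to_subtype).not_gt
          (lt_of_lt_of_eq Cardinal.aleph0_lt_continuum h.symm)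
      · intro h
        have := (hE.measurableSet_class x).standardBorel
        exact mk_eq_continuum (A := {y | E y x}) h
    ext x
    rw [mem_ofPred_eq, hunc]
    constructor
    · rintro ⟨⟨⟨_, ⟨y, rfl⟩, hC⟩, t⟩, rfl⟩ h
      have h1 := hmem ⟨_, ⟨y, rfl⟩, hC⟩ t
      exact hC (h.mono fun z hz => E.trans hz (E.symm h1))
    · intro h
      have h1 : x ∈ range (ψ ⟨_, ⟨x, rfl⟩, h⟩) := by
        rw [hψr]
        exact E.refl x
      obtain ⟨t, ht⟩ := h1
      exact ⟨(_, t), ht⟩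

theorem measurable_sigma_mk {ι : Type*} {A : ι → Type*} [∀ i, MeasurableSpace (A i)] (i : ι) :
    Measurable (Sigma.mk i : A i → Sigma A) :=
  measurable_iff_le_map.2 (iInf_le _ i)

theorem measurable_sigma_iff {ι B : Type*} {A : ι → Type*} [∀ i, MeasurableSpace (A i)]
    [MeasurableSpace B] {g : Sigma A → B} :
    Measurable g ↔ ∀ i, Measurable fun a => g ⟨i, a⟩ := by
  refine ⟨fun h i => h.comp (measurable_sigma_mk i), fun h s hs => ?_⟩
  exact MeasurableSpace.measurableSet_iInf.2 fun i => h i hs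

/-- A Borel isomorphism of `X` with a disjoint union of products as in `IsBorelParametrized`. -/
theorem IsSmooth.exists_measurableEquiv_sigma (hE : IsSmooth E)
    (hc : CountablyManyUncountableClasses E) :
    ∃ (Z Y : CPlus.{u} → Type u)
      (_ : ∀ m, MeasurableSpace (Z m)) (_ : ∀ m, StandardBorelSpace (Z m))
      (_ : ∀ m, MeasurableSpace (Y m)) (_ : ∀ m, StandardBorelSpace (Y m))
      (Φ : (Σ m : CPlus.{u}, Z m × Y m) ≃ᵐ X),
      (∀ m, Cardinal.mk (Y m) = (m : Cardinal.{u})) ∧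
      ∀ a b, E (Φ a) (Φ b) ↔
        (⟨a.1, a.2.1⟩ : Σ m : CPlus.{u}, Z m) = ⟨b.1, b.2.1⟩ := by
  have hm : ∀ m : CPlus.{u}, ∃ (Z Y : Type u) (_ : MeasurableSpace Z) (_ : StandardBorelSpace Z)
      (_ : MeasurableSpace Y) (_ : StandardBorelSpace Y) (ψ : Z × Y → X),
      Cardinal.mk Y = (m : Cardinal.{u}) ∧ Measurable ψ ∧ Function.Injective ψ ∧
      range ψ = {x | Cardinal.mk {y // E y x} = (m : Cardinal.{u})} ∧
      ∀ p q, E (ψ p) (ψ q) ↔ p.1 = q.1 := by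
    rintro ⟨m, -, hm | rfl⟩
    · exact hE.exists_parametrization_of_le_aleph0 hc hm
    · exact hE.exists_parametrization_continuum hc
  choose Z Y mZ sZ mY sY ψ hY hψ hψi hψr hψE using hm
  have hcl : ∀ m p, Cardinal.mk {y // E y (ψ m p)} = (m : Cardinal.{u}) := by
    intro m p
    have h : ψ m p ∈ range (ψ m) := ⟨p, rfl⟩
    rwa [hψr] at h
  let Ψ : (Σ m : CPlus.{u}, Z m × Y m) → X := fun a => ψ a.1 a.2
  have hΨ : Measurable Ψ := measurable_sigma_iff.2 hψ
  have hΨE : ∀ a b, E (Ψ a) (Ψ b) ↔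
      (⟨a.1, a.2.1⟩ : Σ m : CPlus.{u}, Z m) = ⟨b.1, b.2.1⟩ := by
    rintro ⟨m, p⟩ ⟨n, q⟩
    constructor
    · intro h
      obtain rfl : m = n := by
        refine Subtype.ext ?_
        rw [← hcl m p, ← hcl n q]
        exact Cardinal.mk_congr (Equiv.subtypeEquivRight fun z =>
          ⟨fun hz => E.trans hz h, fun hz => E.trans hz (E.symm h)⟩)
      rw [(hψE m p q).1 h]
    · intro h
      obtain rfl : m = n := congrArg Sigma.fst h
      exact (hψE m p q).2 (by simpa using h)
  have hΨb : Function.Bijective Ψ := by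
    constructor
    · rintro ⟨m, p⟩ ⟨n, q⟩ h
      obtain rfl : m = n := congrArg Sigma.fst ((hΨE ⟨m, p⟩ ⟨n, q⟩).1 (by rw [h]))
      exact congrArg (Sigma.mk m) (hψi m h)
    · intro x
      have h : x ∈ range (ψ ⟨_, hE.mk_class_mem_CPlus x⟩) := by
        rw [hψr]
        rfl
      obtain ⟨p, hp⟩ := h
      exact ⟨⟨_, p⟩, hp⟩
  refine ⟨Z, Y, mZ, sZ, mY, sY, ⟨Equiv.ofBijective Ψ hΨb, hΨ, fun s hs => ?_⟩, hY, hΨE⟩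
  rw [← Equiv.image_eq_preimage_symm]
  -- The inverse is Borel because `CPlus` is countable and each piece is an injective Borel image.
  have h : (Equiv.ofBijective Ψ hΨb) '' s = ⋃ m, ψ m '' ((fun p => ⟨m, p⟩) ⁻¹' s) := by
    ext x
    simp only [mem_image, mem_iUnion, mem_preimage, Sigma.exists]
    rfl
  rw [h]
  exact MeasurableSet.iUnion fun m =>
    (measurable_sigma_mk m hs).image_of_measurable_injOn (hψ m) (hψi m).injOn

/-- A class is a slice `{z} × Y n`, of size `n`. As `Y m` is nonempty, distinct `z` in `Z m` give
distinct classes. -/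
theorem numClasses_eq_mk {X : Type u} {E : Setoid X} {Z Y : CPlus.{u} → Type u} (Φ : (Σ m : CPlus.{u}, Z m × Y m) ≃ X)
    (hY : ∀ m, Cardinal.mk (Y m) = (m : Cardinal.{u}))
    (hΦ : ∀ a b, E (Φ a) (Φ b) ↔
      (⟨a.1, a.2.1⟩ : Σ m : CPlus.{u}, Z m) = ⟨b.1, b.2.1⟩) (m : CPlus.{u}) :
    numClasses E m = Cardinal.mk (Z m) := by
  have hne : ∀ n, Nonempty (Y n) := fun n =>
    Cardinal.mk_ne_zero_iff.1 (by rw [hY n]; exact n.2.1)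
  have hcl : ∀ n (z : Z n) (y : Y n), {x | E x (Φ ⟨n, z, y⟩)} = range fun y => Φ ⟨n, z, y⟩ := by
    intro n z y
    ext x
    obtain ⟨⟨n', z', y'⟩, rfl⟩ := Φ.surjective x
    rw [mem_ofPred_eq, hΦ]
    constructor
    · rintro ⟨⟩
      exact ⟨y', rfl⟩
    · rintro ⟨y'', h⟩
      cases Φ.injective h
      rfl
  have hcard : ∀ n (z : Z n), Cardinal.mk (range fun y => Φ ⟨n, z, y⟩) = (n : Cardinal.{u}) := by
    intro n z
    rw [Cardinal.mk_range_eq, hY]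
    intro y y' h
    cases Φ.injective h
    rfl
  refine (Cardinal.mk_congr (Equiv.ofBijective
    (fun z => ⟨range fun y => Φ ⟨m, z, y⟩, ⟨Φ ⟨m, z, (hne m).some⟩, (hcl _ _ _).symm⟩,
      hcard m z⟩) ⟨fun z z' h => ?_, ?_⟩)).symm
  · have h1 : Φ ⟨m, z, (hne m).some⟩ ∈ range fun y => Φ ⟨m, z', y⟩ := by
      rw [← show (range fun y => Φ ⟨m, z, y⟩) = range fun y => Φ ⟨m, z', y⟩ from
        congrArg Subtype.val h]
      exact ⟨_, rfl⟩
    obtain ⟨y, hy⟩ := h1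
    cases Φ.injective hy
    rfl
  · rintro ⟨_, ⟨x, rfl⟩, hx⟩
    obtain ⟨⟨n, z, y⟩, rfl⟩ := Φ.surjective x
    have hnm : n = m := by
      refine Subtype.ext ?_
      rw [← hx, ← hcard n z]
      exact congrArg (fun s : Set X => Cardinal.mk s) (hcl n z y).symm
    subst hnm
    exact ⟨z, Subtype.ext (hcl n z y).symm⟩

theorem BorelIsomorphic.fineShape_eq {X Y : Type u} [MeasurableSpace X] [MeasurableSpace Y]
    {E : Setoid X} {F : Setoid Y} (h : BorelIsomorphic E F) : fineShape E = fineShape F := by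
  obtain ⟨f, hf, -, hEF⟩ := h
  let e := Equiv.ofBijective f hf
  have hcl : ∀ C : Set X, C ∈ E.classes ↔ e '' C ∈ F.classes := by
    have himg : ∀ x, e '' {y | E y x} = {y | F y (e x)} := by
      intro x
      ext y
      obtain ⟨y, rfl⟩ := e.surjective y
      rw [e.injective.mem_set_image]
      exact hEF y x
    intro C
    constructor
    · rintro ⟨x, rfl⟩
      exact ⟨e x, himg x⟩
    · rintro ⟨y, hy⟩
      obtain ⟨x, rfl⟩ := e.surjective y
      exact ⟨x, e.injective.image_injective (hy.trans (himg x).symm)⟩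
  funext m
  exact Cardinal.mk_congr ((Equiv.Set.congr e).subtypeEquiv fun C =>
    and_congr (hcl C) (by rw [show Equiv.Set.congr e C = e '' C from rfl,
      Cardinal.mk_image_eq e.injective]))

theorem IsSmooth.isBorelParametrized (hE : IsSmooth E) (hc : CountablyManyUncountableClasses E) :
    IsBorelParametrized E := by
  obtain ⟨Z, Y, mZ, sZ, mY, sY, Φ, hY, hΦ⟩ := hE.exists_measurableEquiv_sigma hc
  refine ⟨Z, Y, mZ, sZ, mY, sY, Φ.symm, hY, Φ.symm.measurable, Φ.symm.bijective, fun x y => ?_⟩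
  rw [← hΦ, Φ.apply_symm_apply, Φ.apply_symm_apply]

theorem IsSmooth.borelIsomorphic_of_fineShape_eq {Y : Type u} [MeasurableSpace Y]
    [StandardBorelSpace Y] {F : Setoid Y} (hE : IsSmooth E) (hF : IsSmooth F)
    (hcE : CountablyManyUncountableClasses E) (hcF : CountablyManyUncountableClasses F)
    (h : fineShape E = fineShape F) : BorelIsomorphic E F := by
  obtain ⟨Z, A, _, _, _, _, Φ, hA, hΦ⟩ := hE.exists_measurableEquiv_sigma hcE
  obtain ⟨Z', A', _, _, _, _, Φ', hA', hΦ'⟩ := hF.exists_measurableEquiv_sigma hcF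
  have hZ : ∀ m, Nonempty (Z m ≃ᵐ Z' m) := by
    intro m
    have h1 : Cardinal.mk (Z m) = Cardinal.mk (Z' m) := by
      rw [← numClasses_eq_mk Φ.toEquiv hA hΦ m, ← numClasses_eq_mk Φ'.toEquiv hA' hΦ' m]
      exact congrFun h m
    obtain ⟨e⟩ := Cardinal.eq.1 h1
    exact ⟨PolishSpace.Equiv.measurableEquiv e⟩
  have hY : ∀ m, Nonempty (A m ≃ᵐ A' m) := by
    intro m
    obtain ⟨e⟩ := Cardinal.eq.1 ((hA m).trans (hA' m).symm)
    exact ⟨PolishSpace.Equiv.measurableEquiv e⟩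
  let eZ := fun m => (hZ m).some
  let eA := fun m => (hY m).some
  let e : (Σ m, Z m × A m) ≃ Σ m, Z' m × A' m :=
    Equiv.sigmaCongrRight fun m => ((eZ m).prodCongr (eA m)).toEquiv
  have he : Measurable e := measurable_sigma_iff.2 fun m =>
    (measurable_sigma_mk m).comp ((eZ m).prodCongr (eA m)).measurable
  refine ⟨fun x => Φ' (e (Φ.symm x)),
    Φ'.bijective.comp (e.bijective.comp Φ.symm.bijective),
    Φ'.measurable.comp (he.comp Φ.symm.measurable), fun x y => ?_⟩
  obtain ⟨⟨m, z, a⟩, rfl⟩ := Φ.surjective x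
  obtain ⟨⟨n, w, b⟩, rfl⟩ := Φ.surjective y
  rw [hΦ, hΦ', Φ.symm_apply_apply, Φ.symm_apply_apply]
  constructor
  · rintro ⟨⟩
    rfl
  · intro h
    obtain rfl : m = n := congrArg Sigma.fst h
    have h1 : eZ m z = eZ m w := eq_of_heq (Sigma.mk.inj h).2
    rw [(eZ m).injective h1]

theorem IsCountable.countablyManyUncountableClasses {X : Type u} {E : Setoid X}
    (h : IsCountable E) : CountablyManyUncountableClasses E := by
  have h0 : {C : Set X | C ∈ E.classes ∧ ¬ C.Countable} = ∅ :=
    eq_empty_of_forall_notMem fun C hC => hC.2 (h C hC.1)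
  rw [CountablyManyUncountableClasses, h0]
  exact countable_empty

end BorelER

end Parametrization

theorem proposition3p4 :
    (∀ (X Y : Type u) [MeasurableSpace X] [StandardBorelSpace X]
        [MeasurableSpace Y] [StandardBorelSpace Y] (E : Setoid X) (F : Setoid Y),
        BorelER.IsSmooth E → BorelER.IsSmooth F →
        BorelER.CountablyManyUncountableClasses E →
        BorelER.CountablyManyUncountableClasses F →
        (BorelER.BorelIsomorphic E F ↔ BorelER.fineShape E = BorelER.fineShape F)) ∧
    (∀ (X : Type u) [MeasurableSpace X] [StandardBorelSpace X] (E : Setoid X),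
        BorelER.IsSmooth E → BorelER.CountablyManyUncountableClasses E →
        BorelER.IsBorelParametrized E) ∧
    (∀ (X : Type u) [MeasurableSpace X] [StandardBorelSpace X] (E : Setoid X),
        BorelER.IsSmooth E → BorelER.IsCountable E →
        BorelER.IsBorelParametrized E) := by
  exact ⟨fun X Y _ _ _ _ E F hE hF hcE hcF => ⟨fun h => h.fineShape_eq,
      hE.borelIsomorphic_of_fineShape_eq hF hcE hcF⟩,
    fun X _ _ E hE hc => hE.isBorelParametrized hc,
    fun X _ _ E hE hc => hE.isBorelParametrized hc.countablyManyUncountableClasses⟩
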